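/- Let $\mathcal U=\{u_1,\dots,u_n\}$ be a universe and $\mathcal S=(S_1,\dots,S_m)$ a finite family of subsets of $\mathcal U$, both public, and let the private input be a subset $R\subseteq\mathcal U$. Let $f=\max_{u\in\mathcal U}|\{i: u\in S_i\}|$ be the maximum degree of an element. Let $\mathrm{OPT}(R)$ be the minimum number of sets of $\mathcal S$ that together cover all elements of $R\cap\bigcup_i S_i$. For an ordering $\sigma$ of the sets of $\mathcal S$, let $\mathrm{cost}_R(\sigma)$ be the size of the implicit set cover given by $\sigma$, that is, the number of sets that are the first set in the ordering containing $u$ for at least one $u\in R\cap\bigcup_i S_i$. A randomized mechanism $M$ with input $R$ is $\varepsilon$-node differentially private if $\Pr[M(R_1)\in Y]\le e^{\varepsilon}\Pr[M(R_2)\in Y]$ for every set $Y$ of outputs and all $R_1,R_2\subseteq\mathcal U$ with $|R_1\triangle R_2|=1$. **Corollary.** There are absolute constants $C$ and $c\in\mathbb N$ and a randomized algorithm which takes $(\mathcal U,\mathcal S)$, $\varepsilon>0$ and $R$, outputs an ordering $\sigma$ of the sets of $\mathcal S$, and satisfies the following for all $n$, $m$, $\mathcal S$ and $\varepsilon>0$: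 1. for fixed $(\mathcal U,\mathcal S)$ and $\varepsilon$, the algorithm is $\varepsilon$-node differentially private; 2. if $n\ge 2$, then for every $R\subseteq\mathcal U$, with probability at least $1-1/n^2$, $$\mathrm{cost}_R(\sigma)\;\le\; C\,(\log n)^c\,\max\{1,f/\varepsilon\}\cdot \mathrm{OPT}(R).$$ In particular, whenever $\varepsilon\le f$ (for instance whenever $\varepsilon\le 1\le f$), the approximation ratio is $O(f\cdot\mathrm{polylog}(n)/\varepsilon)$ with high probability. Here an algorithm means a randomized mechanism; no running time is claimed. -/

import Mathlib

namespace PrivateSetCover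

/-- A set system `S_1, …, S_m` over the universe of `n` elements `Fin n`. -/
abbrev SetSystem (n m : ℕ) : Type := Fin m → Finset (Fin n)

/-- The degree of an element: the number of sets of the system that contain it. -/
def degree {n m : ℕ} (S : SetSystem n m) (u : Fin n) : ℕ :=
  (Finset.univ.filter fun i : Fin m => u ∈ S i).card

/-- The parameter `f`: the maximum degree of an element (`0` for the empty universe). -/
def maxDegree {n m : ℕ} (S : SetSystem n m) : ℕ :=
  Finset.univ.sup (degree S)

/-- The sets with index in `T` cover every element of `R` that lies in some set of the system. -/
def IsCover {n m : ℕ} (S : SetSystem n m) (R : Finset (Fin n)) (T : Finset (Fin m)) : Prop :=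
  ∀ u ∈ R, (∃ i, u ∈ S i) → ∃ i ∈ T, u ∈ S i

/-- The minimum number of sets in a cover of `R`. -/
noncomputable def opt {n m : ℕ} (S : SetSystem n m) (R : Finset (Fin n)) : ℕ :=
  sInf {k : ℕ | ∃ T : Finset (Fin m), IsCover S R T ∧ T.card = k}

/-- An implicit solution: an ordering of the sets, where `σ k` is the set in position `k`. -/
abbrev Ordering (m : ℕ) : Type := Equiv.Perm (Fin m)

/-- The set cover described by an ordering: the sets that are, for at least one element of `R`,
the first set in the ordering that contains this element. -/
def implicitCover {n m : ℕ} (S : SetSystem n m) (R : Finset (Fin n)) (σ : Ordering m) :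
    Finset (Fin m) :=
  Finset.univ.filter fun i : Fin m =>
    ∃ u ∈ R, u ∈ S i ∧ ∀ j : Fin m, u ∈ S j → σ.symm i ≤ σ.symm j

/-- Two private inputs are node-neighboring if they differ by exactly one element. -/
def NodeNeighbors {n : ℕ} (R₁ R₂ : Finset (Fin n)) : Prop :=
  (symmDiff R₁ R₂).card = 1

/-- Pure `ε`-node differential privacy of a randomized mechanism whose private input is the
set `R` of elements that have to be covered. -/
def IsNodeDP {n : ℕ} {β : Type} (ε : ℝ) (M : Finset (Fin n) → PMF β) : Prop :=
  ∀ R₁ R₂ : Finset (Fin n), NodeNeighbors R₁ R₂ → ∀ Y : Set β,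
    (M R₁).toOuterMeasure Y ≤ ENNReal.ofReal (Real.exp ε) * (M R₂).toOuterMeasure Y

/-- A randomized algorithm for implicit Set Cover: from the public set system, the privacy
parameter and the private set `R` it produces a random ordering of the sets. -/
abbrev ImplicitSetCoverAlgorithm : Type :=
  ∀ n m : ℕ, SetSystem n m → ℝ → Finset (Fin n) → PMF (Ordering m)

end PrivateSetCover

namespace PrivateSetCover

open Finset

/-! ### Probability mass functions -/

/-! Two regimes. If `ε ≥ 3 log n`, randomized response returns `R` unchanged with probability at
least `1 - 1/n²`, and solving the noisy input optimally is post-processing.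

If `ε < 3 log n`, a noisy greedy algorithm makes `L = Nat.clog 2 n` passes over the nonempty sets
with geometrically decreasing thresholds. A set is taken with probability `sigmoid (η * (residual -
threshold))`. Privacy: an element changes only the residuals of sets containing it, each by at most
1. This affects at most `f * L` coins, each costing a factor `exp η`, and `η = ε / (f * L)`
(`noisyGreedy_apply_le`). Accuracy: outside a window of radius `τ = 8 log n / η` a coin errs with
probability at most `n⁻⁸`, so a union bound makes all decisions correct up to `τ`
(`noisyGreedy_not_reaches_le`). Then each pass takes at most `4 OPT` sets and the final residuals
are at most `4τ` (`Reaches.passes_bounds`). So at most `4τ OPT` elements stay uncovered, and each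
costs at most one further set (`implicitCover_frontOrdering_card_le`). -/

theorem toOuterMeasure_le_mul_of_apply_le {α : Type*} {p q : PMF α} {c : ENNReal}
    (h : ∀ x, p x ≤ c * q x) (Y : Set α) :
    p.toOuterMeasure Y ≤ c * q.toOuterMeasure Y := by
  rw [PMF.toOuterMeasure_apply, PMF.toOuterMeasure_apply, ← ENNReal.tsum_mul_left]
  refine ENNReal.tsum_le_tsum fun x => ?_
  by_cases hx : x ∈ Y <;> simp [hx, h x]

theorem toOuterMeasure_univ_eq_one {α : Type*} (p : PMF α) : p.toOuterMeasure Set.univ = 1 := by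
  rw [PMF.toOuterMeasure_apply_eq_one_iff]
  exact Set.subset_univ _

theorem toOuterMeasure_le_one {α : Type*} (p : PMF α) (Y : Set α) : p.toOuterMeasure Y ≤ 1 :=
  (p.toOuterMeasure.mono (Set.subset_univ Y)).trans_eq (toOuterMeasure_univ_eq_one p)

theorem ofReal_one_sub_le_toOuterMeasure {α : Type*} (p : PMF α) {Y : Set α} {b : ℝ}
    (hb : 0 ≤ b) (h : p.toOuterMeasure Yᶜ ≤ ENNReal.ofReal b) :
    ENNReal.ofReal (1 - b) ≤ p.toOuterMeasure Y := by
  rw [ENNReal.ofReal_sub _ hb, ENNReal.ofReal_one, tsub_le_iff_right]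
  calc (1 : ENNReal) = p.toOuterMeasure (Y ∪ Yᶜ) := by
        rw [Set.union_compl_self, toOuterMeasure_univ_eq_one]
    _ ≤ p.toOuterMeasure Y + p.toOuterMeasure Yᶜ := MeasureTheory.measure_union_le _ _
    _ ≤ _ := by gcongr

/-- Post-processing preserves differential privacy. -/
theorem IsNodeDP.map {n : ℕ} {α β : Type} {ε : ℝ} {M : Finset (Fin n) → PMF α}
    (h : IsNodeDP ε M) (g : α → β) : IsNodeDP ε fun R => (M R).map g := by
  intro R₁ R₂ hR Y
  rw [PMF.toOuterMeasure_map_apply, PMF.toOuterMeasure_map_apply]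
  exact h R₁ R₂ hR _

/-- The coin that shows `true` with probability `Real.sigmoid x`. -/
noncomputable def sigmoidCoin (x : ℝ) : PMF Bool :=
  PMF.ofFintype (fun b => ENNReal.ofReal (Real.sigmoid (bif b then x else -x))) (by
    rw [Fintype.sum_bool, cond_true, cond_false,
      ← ENNReal.ofReal_add (Real.sigmoid_nonneg _) (Real.sigmoid_nonneg _), Real.sigmoid_neg]
    simp)

theorem sigmoidCoin_apply (x : ℝ) (b : Bool) :
    sigmoidCoin x b = ENNReal.ofReal (Real.sigmoid (bif b then x else -x)) := rfl

theorem sigmoid_le_exp (x : ℝ) : Real.sigmoid x ≤ Real.exp x := by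
  rw [Real.sigmoid_def, ← inv_inv (Real.exp x), ← Real.exp_neg]
  have := Real.exp_pos (-x)
  gcongr
  linarith

/-- The logarithm of the sigmoid is monotone and 1-Lipschitz. As `1 - sigmoid x = sigmoid (-x)`,
this controls both faces of the coin. -/
theorem sigmoid_le_exp_mul {x y d : ℝ} (h : x ≤ y + d) (hd : 0 ≤ d) :
    Real.sigmoid x ≤ Real.exp d * Real.sigmoid y := by
  refine (Real.sigmoid_le h).trans ?_
  rw [Real.sigmoid_def, Real.sigmoid_def, ← inv_inv (Real.exp d), ← mul_inv, ← Real.exp_neg]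
  have h1 : Real.exp (-d) ≤ 1 := Real.exp_le_one_iff.2 (by linarith)
  have h2 := Real.exp_pos (-d)
  have h3 := Real.exp_pos (-y)
  have : Real.exp (-(y + d)) = Real.exp (-d) * Real.exp (-y) := by
    rw [← Real.exp_add]; ring_nf
  rw [this]
  gcongr
  linarith

theorem sigmoidCoin_apply_le {x y d : ℝ} (h : |x - y| ≤ d) (b : Bool) :
    sigmoidCoin x b ≤ ENNReal.ofReal (Real.exp d) * sigmoidCoin y b := by
  obtain ⟨h1, h2⟩ := abs_le.1 h
  have hd : 0 ≤ d := (abs_nonneg _).trans h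
  rw [sigmoidCoin_apply, sigmoidCoin_apply, ← ENNReal.ofReal_mul (Real.exp_nonneg _)]
  apply ENNReal.ofReal_le_ofReal
  cases b
  · exact sigmoid_le_exp_mul (by simp only [cond_false]; linarith) hd
  · exact sigmoid_le_exp_mul (by simp only [cond_true]; linarith) hd

/-! ### Covers and orderings -/

section Cover

variable {n m : ℕ} (S : SetSystem n m) (R : Finset (Fin n))

/-- The coverable elements of `R` that lie in none of the sets with index in `P`. -/
def uncovered (P : Finset (Fin m)) : Finset (Fin n) :=
  R.filter fun u => (∃ i, u ∈ S i) ∧ ∀ j ∈ P, u ∉ S j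

/-- The number of elements of `R` in `S i` that lie in none of the sets with index in `P`. -/
def residual (P : Finset (Fin m)) (i : Fin m) : ℕ :=
  (R.filter fun u => u ∈ S i ∧ ∀ j ∈ P, u ∉ S j).card

/-- An ordering in which the sets with index in `P` precede all others. -/
def frontOrdering (P : Finset (Fin m)) : Ordering m :=
  Tuple.sort fun i => if i ∈ P then 0 else 1

theorem mem_of_frontOrdering_symm_le {P : Finset (Fin m)} {i j : Fin m} (hi : i ∈ P)
    (h : (frontOrdering P).symm j ≤ (frontOrdering P).symm i) : j ∈ P := by
  have := Tuple.monotone_sort (fun i => if i ∈ P then 0 else 1) h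
  by_contra hj
  simp [frontOrdering, Function.comp, hi, hj] at this

/-- Charge each set to an element for which it comes first; an element has only one first set. -/
theorem card_first_le (σ : Ordering m) (V : Finset (Fin n)) :
    (univ.filter fun i : Fin m =>
      ∃ u ∈ V, u ∈ S i ∧ ∀ j : Fin m, u ∈ S j → σ.symm i ≤ σ.symm j).card ≤ V.card := by
  refine card_le_card_of_forall_subsingleton
    (fun i u => u ∈ S i ∧ ∀ j : Fin m, u ∈ S j → σ.symm i ≤ σ.symm j) ?_ ?_
  · intro i hi
    simpa using hi
  · intro u _ i hi j hj
    exact σ.symm.injective (le_antisymm (hi.2.2 j hj.2.1) (hj.2.2 i hi.2.1))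

theorem implicitCover_card_le_uncovered_empty (σ : Ordering m) :
    (implicitCover S R σ).card ≤ (uncovered S R ∅).card := by
  refine (card_le_card ?_).trans (card_first_le S σ _)
  intro i hi
  obtain ⟨u, hu, hui, h⟩ := (mem_filter.1 hi).2
  exact mem_filter.2 ⟨mem_univ _, u, by simp [uncovered, hu]; exact ⟨i, hui⟩, hui, h⟩

theorem implicitCover_frontOrdering_card_le (P : Finset (Fin m)) :
    (implicitCover S R (frontOrdering P)).card ≤ P.card + (uncovered S R P).card := by
  refine (card_le_card (t := P ∪ _) ?_).trans ((card_union_le _ _).trans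
    (Nat.add_le_add_left (card_first_le S (frontOrdering P) (uncovered S R P)) _))
  intro i hi
  obtain ⟨u, hu, hui, h⟩ := (mem_filter.1 hi).2
  by_cases hP : ∃ j ∈ P, u ∈ S j
  · obtain ⟨j, hj, huj⟩ := hP
    exact mem_union_left _ (mem_of_frontOrdering_symm_le hj (h j huj))
  · push Not at hP
    exact mem_union_right _
      (mem_filter.2 ⟨mem_univ _, u, mem_filter.2 ⟨hu, ⟨i, hui⟩, hP⟩, hui, h⟩)

theorem exists_isCover_card_eq_opt : ∃ T, IsCover S R T ∧ T.card = opt S R :=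
  Nat.sInf_mem (s := {k : ℕ | ∃ T : Finset (Fin m), IsCover S R T ∧ T.card = k})
    ⟨_, univ, fun _ _ ⟨i, hi⟩ => ⟨i, mem_univ i, hi⟩, rfl⟩

theorem IsCover.uncovered_eq_empty {T : Finset (Fin m)} (hT : IsCover S R T) :
    uncovered S R T = ∅ := by
  refine filter_eq_empty_iff.2 fun u hu h => ?_
  obtain ⟨i, hi, hui⟩ := hT u hu h.1
  exact h.2 i hi hui

theorem one_le_opt (h : (uncovered S R ∅).Nonempty) : 1 ≤ opt S R := by
  obtain ⟨T, hT, hc⟩ := exists_isCover_card_eq_opt S R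
  obtain ⟨u, hu⟩ := h
  obtain ⟨i, hi, -⟩ := hT u (mem_filter.1 hu).1 (mem_filter.1 hu).2.1
  rw [← hc]
  exact card_pos.2 ⟨i, hi⟩

/-- An optimal cover also covers what `P` misses, and each of its sets accounts for at most `B` of
those elements. -/
theorem card_uncovered_le {P : Finset (Fin m)} {B : ℝ}
    (h : ∀ i, (residual S R P i : ℝ) ≤ B) :
    ((uncovered S R P).card : ℝ) ≤ B * opt S R := by
  obtain ⟨T, hT, hc⟩ := exists_isCover_card_eq_opt S R
  have hsub : uncovered S R P ⊆
      T.biUnion fun i => R.filter fun u => u ∈ S i ∧ ∀ j ∈ P, u ∉ S j := by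
    intro u hu
    obtain ⟨huR, hex, hP⟩ := mem_filter.1 hu
    obtain ⟨i, hi, hui⟩ := hT u huR hex
    exact mem_biUnion.2 ⟨i, hi, mem_filter.2 ⟨huR, hui, hP⟩⟩
  calc ((uncovered S R P).card : ℝ) ≤ (∑ i ∈ T, residual S R P i : ℕ) := by
        exact_mod_cast (card_le_card hsub).trans card_biUnion_le
    _ = ∑ i ∈ T, (residual S R P i : ℝ) := by push_cast; rfl
    _ ≤ ∑ _i ∈ T, B := sum_le_sum fun i _ => h i
    _ = B * opt S R := by rw [sum_const, hc, nsmul_eq_mul, mul_comm]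

theorem residual_add_card_uncovered_insert (P : Finset (Fin m)) (i : Fin m) :
    residual S R P i + (uncovered S R (insert i P)).card = (uncovered S R P).card := by
  rw [← card_filter_add_card_filter_not (s := uncovered S R P) fun u => u ∈ S i, residual]
  congr 2
  · ext u
    simp only [uncovered, mem_filter]
    constructor
    · rintro ⟨h1, h2, h3⟩; exact ⟨⟨h1, ⟨i, h2⟩, h3⟩, h2⟩
    · rintro ⟨⟨h1, -, h3⟩, h2⟩; exact ⟨h1, h2, h3⟩
  · ext u
    simp only [uncovered, mem_filter, forall_mem_insert]
    tauto

theorem residual_anti {P Q : Finset (Fin m)} (h : P ⊆ Q) (i : Fin m) :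
    residual S R Q i ≤ residual S R P i :=
  card_le_card fun _ hu => mem_filter.2
    ⟨(mem_filter.1 hu).1, (mem_filter.1 hu).2.1, fun j hj => (mem_filter.1 hu).2.2 j (h hj)⟩

theorem residual_eq_zero {P : Finset (Fin m)} {i : Fin m} (h : i ∈ P) :
    residual S R P i = 0 :=
  card_eq_zero.2 (filter_eq_empty_iff.2 fun _ _ hu => hu.2 i h hu.1)

theorem residual_eq_zero_of_eq_empty (P : Finset (Fin m)) {i : Fin m} (h : S i = ∅) :
    residual S R P i = 0 :=
  card_eq_zero.2 (filter_eq_empty_iff.2 fun u _ hu => by simp [h] at hu)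

theorem residual_le (P : Finset (Fin m)) (i : Fin m) : residual S R P i ≤ n := by
  simpa [residual] using card_le_univ (R.filter fun u => u ∈ S i ∧ ∀ j ∈ P, u ∉ S j)

theorem degree_le_maxDegree (u : Fin n) : degree S u ≤ maxDegree S :=
  le_sup (f := degree S) (mem_univ u)

/-- The indices of the nonempty sets. -/
def nonemptySets : Finset (Fin m) := univ.filter fun i => (S i).Nonempty

/-- Keeps `m` out of the union bound: only nonempty sets are ever tested. -/
theorem card_nonemptySets_le : (nonemptySets S).card ≤ n * maxDegree S := by
  have hsub : nonemptySets S ⊆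
      (univ : Finset (Fin n)).biUnion fun u => univ.filter fun i : Fin m => u ∈ S i := by
    intro i hi
    obtain ⟨u, hu⟩ := (mem_filter.1 hi).2
    exact mem_biUnion.2 ⟨u, mem_univ _, mem_filter.2 ⟨mem_univ _, hu⟩⟩
  refine (card_le_card hsub).trans ((card_biUnion_le_card_mul _ _ (maxDegree S) fun u _ =>
    degree_le_maxDegree S u).trans_eq ?_)
  simp

end Cover

/-- Neighboring inputs arise from each other by inserting one element. -/
theorem NodeNeighbors.exists_insert {n : ℕ} {R₁ R₂ : Finset (Fin n)} (h : NodeNeighbors R₁ R₂) :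
    ∃ u, (u ∉ R₁ ∧ R₂ = insert u R₁) ∨ (u ∉ R₂ ∧ R₁ = insert u R₂) := by
  obtain ⟨u, hu⟩ := card_eq_one.1 h
  have key : ∀ v, ((v ∈ R₁ ∧ v ∉ R₂) ∨ (v ∈ R₂ ∧ v ∉ R₁)) ↔ v = u := by
    intro v
    rw [← mem_symmDiff, hu, mem_singleton]
  refine ⟨u, ?_⟩
  rcases (key u).2 rfl with ⟨h1, h2⟩ | ⟨h1, h2⟩
  · right
    refine ⟨h2, ?_⟩
    ext v
    rw [mem_insert]
    by_cases hv : v = u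
    · simp [hv, h1]
    · have := (key v).not.2 hv
      tauto
  · left
    refine ⟨h2, ?_⟩
    ext v
    rw [mem_insert]
    by_cases hv : v = u
    · simp [hv, h1]
    · have := (key v).not.2 hv
      tauto

theorem residual_insert_of_mem {n m : ℕ} (S : SetSystem n m) {R : Finset (Fin n)} {u : Fin n}
    (P : Finset (Fin m)) (i : Fin m) (hu : u ∉ R) :
    residual S R P i ≤ residual S (insert u R) P i ∧
      residual S (insert u R) P i ≤ residual S R P i + if u ∈ S i then 1 else 0 := by
  unfold residual
  rw [filter_insert]
  by_cases hi : u ∈ S i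
  · by_cases hP : ∀ j ∈ P, u ∉ S j
    · rw [if_pos ⟨hi, hP⟩, if_pos hi, card_insert_of_notMem (by simp [hu])]
      omega
    · rw [if_neg (by tauto)]
      simp
  · rw [if_neg (by tauto)]
    simp

/-- Changing the input in one element `u` changes only the residuals of sets containing `u`. -/
theorem NodeNeighbors.exists_residual_sub_le {n m : ℕ} (S : SetSystem n m)
    {R₁ R₂ : Finset (Fin n)} (h : NodeNeighbors R₁ R₂) :
    ∃ u, ∀ P i, |(residual S R₁ P i : ℝ) - residual S R₂ P i| ≤ if u ∈ S i then 1 else 0 := by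
  obtain ⟨u, ⟨hu, rfl⟩ | ⟨hu, rfl⟩⟩ := h.exists_insert <;> refine ⟨u, fun P i => ?_⟩ <;>
  · obtain ⟨h1, h2⟩ := residual_insert_of_mem S P i hu
    rify at h1 h2
    rw [abs_le]
    constructor <;> split_ifs at h2 ⊢ <;> push_cast at h2 <;> linarith

/-! ### The noisy threshold mechanism -/

section Threshold

variable {n m : ℕ} (S : SetSystem n m)

/-- Process a list of pairs of a threshold and a set: a set joins the partial cover if a coin
with bias depending on the difference of its residual and the threshold shows `true`. -/
noncomputable def noisyGreedy (η : ℝ) (R : Finset (Fin n)) :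
    List (ℝ × Fin m) → Finset (Fin m) → PMF (Finset (Fin m))
  | [], P => PMF.pure P
  | x :: l, P => (sigmoidCoin (η * (residual S R P x.2 - x.1))).bind fun b =>
      noisyGreedy η R l (bif b then insert x.2 P else P)

/-- Adaptive composition: the coins are compared given the same partial cover `P`, and only coins of
sets containing `u` contribute a factor `exp η`. -/
theorem noisyGreedy_apply_le {η : ℝ} (hη : 0 ≤ η) {R₁ R₂ : Finset (Fin n)} {u : Fin n}
    (hu : ∀ P i, |(residual S R₁ P i : ℝ) - residual S R₂ P i| ≤ if u ∈ S i then 1 else 0)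
    (l : List (ℝ × Fin m)) (P X : Finset (Fin m)) :
    noisyGreedy S η R₁ l P X ≤
      ENNReal.ofReal (Real.exp (η * l.countP fun x => u ∈ S x.2)) * noisyGreedy S η R₂ l P X := by
  induction l generalizing P with
  | nil =>
    simp only [noisyGreedy, List.countP_nil, Nat.cast_zero, mul_zero, Real.exp_zero,
      ENNReal.ofReal_one, one_mul, le_refl]
  | cons x l ih =>
    simp only [noisyGreedy, PMF.bind_apply]
    rw [← ENNReal.tsum_mul_left]
    refine ENNReal.tsum_le_tsum fun b => ?_
    have hcoin := sigmoidCoin_apply_le (x := η * (residual S R₁ P x.2 - x.1))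
      (y := η * (residual S R₂ P x.2 - x.1)) (d := η * if u ∈ S x.2 then 1 else 0) (by
        rw [← mul_sub, abs_mul, abs_of_nonneg hη, sub_sub_sub_cancel_right]
        exact mul_le_mul_of_nonneg_left (hu P x.2) hη) b
    refine (mul_le_mul' hcoin (ih _)).trans_eq ?_
    rw [mul_mul_mul_comm, ← ENNReal.ofReal_mul (Real.exp_nonneg _), ← Real.exp_add, ← mul_add,
      List.countP_cons]
    congr 4
    split_ifs with h <;> simp_all [add_comm]

/-- `Q` is reached from `P` if each processed set with residual at most `t - τ` is skipped and
each one with residual at least `t + τ` is taken, where `t` is its threshold. -/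
def Reaches (R : Finset (Fin n)) (τ : ℝ) :
    List (ℝ × Fin m) → Finset (Fin m) → Finset (Fin m) → Prop
  | [], P, Q => Q = P
  | x :: l, P, Q =>
      (x.1 - τ < residual S R P x.2 ∧ Reaches R τ l (insert x.2 P) Q) ∨
        (residual S R P x.2 < x.1 + τ ∧ Reaches R τ l P Q)

theorem noisyGreedy_not_reaches_le {η : ℝ} (hη : 0 ≤ η) (R : Finset (Fin n)) {τ : ℝ}
    (hτ : 0 < τ) (l : List (ℝ × Fin m)) (P : Finset (Fin m)) :
    (noisyGreedy S η R l P).toOuterMeasure {Q | Reaches S R τ l P Q}ᶜ ≤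
      l.length * ENNReal.ofReal (Real.exp (-(η * τ))) := by
  induction l generalizing P with
  | nil => simp [noisyGreedy, Reaches]
  | cons x l ih =>
    set δ := ENNReal.ofReal (Real.exp (-(η * τ))) with hδ
    set r := (residual S R P x.2 : ℝ)
    simp only [noisyGreedy, PMF.toOuterMeasure_bind_apply, tsum_bool, cond_true, cond_false]
    have hsum : sigmoidCoin (η * (r - x.1)) false + sigmoidCoin (η * (r - x.1)) true = 1 := by
      rw [← tsum_bool (sigmoidCoin (η * (r - x.1)))]
      exact PMF.tsum_coe _
    have h1 : ∀ b, sigmoidCoin (η * (r - x.1)) b ≤ 1 := fun b => PMF.coe_le_one _ _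
    have hpush : ((x :: l).length : ENNReal) * δ = δ + l.length * δ := by
      rw [List.length_cons]; push_cast; ring
    rw [hpush]
    have htrue : x.1 - τ < r → (noisyGreedy S η R l (insert x.2 P)).toOuterMeasure
        {Q | Reaches S R τ (x :: l) P Q}ᶜ ≤ l.length * δ := fun h =>
      (MeasureTheory.measure_mono (Set.compl_subset_compl.2 fun Q hQ => Or.inl ⟨h, hQ⟩)).trans (ih _)
    have hfalse : r < x.1 + τ → (noisyGreedy S η R l P).toOuterMeasure
        {Q | Reaches S R τ (x :: l) P Q}ᶜ ≤ l.length * δ := fun h =>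
      (MeasureTheory.measure_mono (Set.compl_subset_compl.2 fun Q hQ => Or.inr ⟨h, hQ⟩)).trans (ih _)
    by_cases h2 : x.1 - τ < r
    -- Inside the window both outcomes are allowed, so this coin adds no failure probability;
    -- outside it, the one forbidden outcome has probability at most `δ`.
    · by_cases h3 : r < x.1 + τ
      · calc _ ≤ sigmoidCoin (η * (r - x.1)) false * (l.length * δ) +
              sigmoidCoin (η * (r - x.1)) true * (l.length * δ) := by
              gcongr
              · exact hfalse h3
              · exact htrue h2
          _ = l.length * δ := by rw [← add_mul, hsum, one_mul]
          _ ≤ _ := le_add_self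
      · have hp : sigmoidCoin (η * (r - x.1)) false ≤ δ := by
          rw [sigmoidCoin_apply, hδ]
          refine ENNReal.ofReal_le_ofReal ((sigmoid_le_exp _).trans (Real.exp_le_exp.2 ?_))
          rw [cond_false, neg_le_neg_iff]
          exact mul_le_mul_of_nonneg_left (by linarith) hη
        calc _ ≤ δ * 1 + 1 * (l.length * δ) := by
              gcongr
              · exact toOuterMeasure_le_one _ _
              · exact h1 _
              · exact htrue h2
          _ = _ := by rw [mul_one, one_mul]
    · have hp : sigmoidCoin (η * (r - x.1)) true ≤ δ := by
        rw [sigmoidCoin_apply, hδ]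
        refine ENNReal.ofReal_le_ofReal ((sigmoid_le_exp _).trans (Real.exp_le_exp.2 ?_))
        rw [cond_true, ← mul_neg]
        exact mul_le_mul_of_nonneg_left (by linarith) hη
      calc _ ≤ 1 * (l.length * δ) + δ * 1 := by
            gcongr
            · exact h1 _
            · exact hfalse (by linarith)
            · exact toOuterMeasure_le_one _ _
        _ = _ := by rw [mul_one, one_mul, add_comm]

theorem Reaches.exists_of_append {R : Finset (Fin n)} {τ : ℝ} {l₁ l₂ : List (ℝ × Fin m)}
    {P Q : Finset (Fin m)} (h : Reaches S R τ (l₁ ++ l₂) P Q) :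
    ∃ P', Reaches S R τ l₁ P P' ∧ Reaches S R τ l₂ P' Q := by
  induction l₁ generalizing P with
  | nil => exact ⟨P, rfl, h⟩
  | cons x l ih =>
    rcases h with ⟨h1, h2⟩ | ⟨h1, h2⟩
    · obtain ⟨P', h3, h4⟩ := ih h2
      exact ⟨P', Or.inl ⟨h1, h3⟩, h4⟩
    · obtain ⟨P', h3, h4⟩ := ih h2
      exact ⟨P', Or.inr ⟨h1, h3⟩, h4⟩

/-- One pass over a list of sets with threshold `t`. -/
theorem Reaches.pass {R : Finset (Fin n)} {τ t : ℝ} (hτ : 0 < τ) (ht : τ ≤ t)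
    {is : List (Fin m)} {P Q : Finset (Fin m)} (h : Reaches S R τ (is.map (Prod.mk t)) P Q) :
    P ⊆ Q ∧ (t - τ) * Q.card + (uncovered S R Q).card ≤
        (t - τ) * P.card + (uncovered S R P).card ∧
      ∀ i ∈ is, (residual S R Q i : ℝ) < t + τ := by
  induction is generalizing P with
  | nil =>
    obtain rfl : Q = P := h
    exact ⟨Subset.rfl, le_rfl, by simp⟩
  | cons i l ih =>
    rcases h with ⟨h1, h2⟩ | ⟨h1, h2⟩
    · obtain ⟨h3, h4, h5⟩ := ih h2
      refine ⟨(subset_insert _ _).trans h3, h4.trans ?_, ?_⟩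
      · have h6 := residual_add_card_uncovered_insert S R P i
        have h7 := card_insert_le i P
        rify at h6 h7
        have h8 := mul_le_mul_of_nonneg_left h7 (sub_nonneg.2 ht)
        simp only at h1 h8 ⊢
        linarith
      · rw [List.forall_mem_cons]
        refine ⟨?_, h5⟩
        rw [residual_eq_zero S R (h3 (mem_insert_self i P))]
        push_cast
        linarith
    · obtain ⟨h3, h4, h5⟩ := ih h2
      refine ⟨h3, h4, ?_⟩
      rw [List.forall_mem_cons]
      exact ⟨(Nat.cast_le.2 (residual_anti S R h3 i)).trans_lt h1, h5⟩

/-- Passes over all nonempty sets with thresholds that decrease geometrically. -/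
noncomputable def passes (τ : ℝ) : ℕ → List (ℝ × Fin m)
  | 0 => []
  | k + 1 => (nonemptySets S).toList.map (Prod.mk (2 ^ k * (4 * τ) - τ)) ++ passes τ k

theorem length_passes (τ : ℝ) (k : ℕ) : (passes S τ k).length = k * (nonemptySets S).card := by
  induction k with
  | zero => simp [passes]
  | succ k ih => simp [passes, ih]; ring

theorem countP_passes_le (τ : ℝ) (k : ℕ) (u : Fin n) :
    (passes S τ k).countP (fun x => u ∈ S x.2) ≤ k * maxDegree S := by
  induction k with
  | zero => simp [passes]
  | succ k ih =>
    rw [passes, List.countP_append, List.countP_map, add_mul, one_mul, add_comm]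
    refine add_le_add ih (le_trans ?_ (degree_le_maxDegree S u))
    rw [List.countP_eq_length_filter, ← List.toFinset_card_of_nodup ((nodup_toList _).filter _)]
    refine card_le_card fun i hi => ?_
    simp at hi
    simpa using hi.2

/-- The threshold `t = 2^k * 4τ - τ` makes `t + τ` exactly half of the previous residual bound,
while `t - τ ≥ 2^k * 2τ`. At most `2^(k+1) * 4τ * OPT` elements are uncovered before the pass, so it
takes at most `4 OPT` sets. -/
theorem Reaches.passes_bounds {R : Finset (Fin n)} {τ : ℝ} (hτ : 0 < τ) (k : ℕ)
    {P Q : Finset (Fin m)} (hP : ∀ i, (residual S R P i : ℝ) ≤ 2 ^ k * (4 * τ))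
    (h : Reaches S R τ (passes S τ k) P Q) :
    (Q.card : ℝ) ≤ P.card + 4 * k * opt S R ∧ ∀ i, (residual S R Q i : ℝ) ≤ 4 * τ := by
  induction k generalizing P with
  | zero =>
    obtain rfl : Q = P := h
    exact ⟨by simp, by simpa using hP⟩
  | succ k ih =>
    obtain ⟨P', h1, h2⟩ := Reaches.exists_of_append S h
    have hk : (1 : ℝ) ≤ 2 ^ k := one_le_pow₀ (by norm_num)
    have hkτ : τ ≤ 2 ^ k * τ := le_mul_of_one_le_left hτ.le hk
    obtain ⟨-, h4, h5⟩ := Reaches.pass S hτ (by linarith) h1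
    have hP' : ∀ i, (residual S R P' i : ℝ) ≤ 2 ^ k * (4 * τ) := by
      intro i
      by_cases hi : (S i).Nonempty
      · have := h5 i (by simp [nonemptySets, hi])
        linarith
      · rw [residual_eq_zero_of_eq_empty S R P' (not_nonempty_iff_eq_empty.1 hi)]
        push_cast
        positivity
    obtain ⟨h6, h7⟩ := ih hP' h2
    refine ⟨h6.trans ?_, h7⟩
    have h8 := card_uncovered_le S R hP
    have h9 : (0 : ℝ) ≤ (uncovered S R P').card := Nat.cast_nonneg _
    have h10 : (2 ^ k * τ) * (2 * P'.card) ≤ (2 ^ k * τ) * (2 * P.card + 8 * opt S R) := by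
      have hle : 2 * (2 ^ k * τ) ≤ 2 ^ k * (4 * τ) - τ - τ := by linarith
      have hcard : (P.card : ℝ) ≤ P'.card :=
        Nat.cast_le.2 (card_le_card (Reaches.pass S hτ (by linarith) h1).1)
      have := mul_le_mul_of_nonneg_right hle (sub_nonneg.2 hcard)
      rw [pow_succ] at h8
      linarith
    have h11 := le_of_mul_le_mul_left h10 (by positivity)
    push_cast
    linarith

/-- The noise parameter for which `Nat.clog 2 n` passes satisfy `ε`-node privacy. -/
noncomputable def noiseRate (ε : ℝ) : ℝ := ε / (maxDegree S * Nat.clog 2 n)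

/-- The partial cover selected by `Nat.clog 2 n` noisy passes. -/
noncomputable def thresholdMechanism (ε : ℝ) (R : Finset (Fin n)) : PMF (Finset (Fin m)) :=
  noisyGreedy S (noiseRate S ε) R
    (passes S (8 * Real.log n / noiseRate S ε) (Nat.clog 2 n)) ∅

theorem thresholdMechanism_isNodeDP {ε : ℝ} (hε : 0 < ε) :
    IsNodeDP ε (thresholdMechanism S ε) := by
  intro R₁ R₂ h
  obtain ⟨u, hu⟩ := h.exists_residual_sub_le S
  have hη : 0 ≤ noiseRate S ε := by unfold noiseRate; positivity
  refine toOuterMeasure_le_mul_of_apply_le fun X =>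
    (noisyGreedy_apply_le S hη hu _ _ X).trans
      (mul_le_mul' (ENNReal.ofReal_le_ofReal (Real.exp_le_exp.2 ?_)) le_rfl)
  have h1 := countP_passes_le S (8 * Real.log n / noiseRate S ε) (Nat.clog 2 n) u
  rify at h1
  refine (mul_le_mul_of_nonneg_left h1 hη).trans ?_
  rw [noiseRate, mul_comm (maxDegree S : ℝ)]
  rw [div_mul_eq_mul_div]
  -- An inequality suffices, and it also holds when `f * L = 0`, where division by zero makes the
  -- noise rate `0`.
  exact div_le_of_le_mul₀ (by positivity) hε.le le_rfl

theorem thresholdMechanism_accuracy {ε : ℝ} (hε : 0 < ε) (hn : 2 ≤ n)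
    (hεn : ε ≤ 3 * Real.log n) (hf : 0 < maxDegree S) (hfn : (maxDegree S : ℝ) ≤ n * ε)
    (R : Finset (Fin n)) :
    ENNReal.ofReal (1 - 1 / (n : ℝ) ^ 2) ≤
      (thresholdMechanism S ε R).toOuterMeasure
        {P | (P.card : ℝ) + (uncovered S R P).card ≤
          (4 * Nat.clog 2 n * (1 + 8 * Real.log n * (maxDegree S / ε))) * opt S R} := by
  have hn' : (2 : ℝ) ≤ n := by exact_mod_cast hn
  have hlog : 0 < Real.log n := Real.log_pos (by linarith)
  have hL : 1 ≤ Nat.clog 2 n := Nat.clog_pos (by norm_num) hn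
  have hL' : (1 : ℝ) ≤ Nat.clog 2 n := by exact_mod_cast hL
  have hf' : (1 : ℝ) ≤ maxDegree S := by exact_mod_cast hf
  have hη : 0 < noiseRate S ε := by unfold noiseRate; positivity
  set η := noiseRate S ε with hηdef
  set τ := 8 * Real.log n / η with hτdef
  have hτ : 0 < τ := by positivity
  have hητ : η * τ = 8 * Real.log n := by rw [hτdef]; field_simp
  have hτ' : τ = 8 * Real.log n * (maxDegree S / ε) * Nat.clog 2 n := by
    rw [hτdef, hηdef, noiseRate]; field_simp
  -- Here `ε ≤ 3 log n` enters: `η ≤ ε ≤ 8 log n`. Thus the initial residuals, at most `n ≤ 2^L`,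
  -- satisfy the bound required before the first pass.
  have hτ1 : 1 ≤ τ := by
    rw [hτdef, one_le_div hη, hηdef, noiseRate]
    have h1 : (1 : ℝ) ≤ maxDegree S * Nat.clog 2 n := one_le_mul_of_one_le_of_one_le hf' hL'
    exact (div_le_self hε.le h1).trans (by linarith)
  have hδ : Real.exp (-(η * τ)) = 1 / (n : ℝ) ^ 8 := by
    rw [hητ, Real.exp_neg, mul_comm, Real.exp_mul, Real.exp_log (by linarith), one_div]
    norm_cast
  refine ofReal_one_sub_le_toOuterMeasure _ (by positivity) ?_
  refine le_trans ((PMF.toOuterMeasure _).mono (Set.compl_subset_compl.2 ?_))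
    ((noisyGreedy_not_reaches_le S hη.le R hτ (passes S τ (Nat.clog 2 n)) ∅).trans ?_)
  · intro Q hQ
    obtain ⟨h1, h2⟩ := Reaches.passes_bounds S hτ (Nat.clog 2 n) (fun i => by
      have h3 : (residual S R ∅ i : ℝ) ≤ n := Nat.cast_le.2 (residual_le S R ∅ i)
      have h4 : (n : ℝ) ≤ 2 ^ Nat.clog 2 n := by exact_mod_cast Nat.le_pow_clog (by norm_num) n
      have h5 : (2 : ℝ) ^ Nat.clog 2 n ≤ 2 ^ Nat.clog 2 n * (4 * τ) :=
        le_mul_of_one_le_right (by positivity) (by linarith)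
      linarith) hQ
    have h3 := card_uncovered_le S R h2
    rw [hτ'] at h3
    simp only [card_empty, Nat.cast_zero, zero_add] at h1
    change (Q.card : ℝ) + (uncovered S R Q).card ≤ _
    linarith
  · rw [hδ, length_passes, ← ENNReal.ofReal_natCast,
      ← ENNReal.ofReal_mul (Nat.cast_nonneg _)]
    apply ENNReal.ofReal_le_ofReal
    -- There are at most `L * n * f ≤ 3n⁴ ≤ n⁶` coins, using `f ≤ n * ε ≤ 3n²`; hence the exponent 8
    -- in the error of a single coin.
    have h1 : Nat.clog 2 n ≤ n := Nat.clog_le_of_le_pow Nat.lt_two_pow_self.le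
    have h2 : ((nonemptySets S).card : ℝ) ≤ n * maxDegree S := by
      exact_mod_cast card_nonemptySets_le S
    have h3 : (maxDegree S : ℝ) ≤ n * (3 * n) := by
      have := Real.log_le_self (x := n) (by linarith)
      exact hfn.trans (by gcongr; linarith)
    have h4 : ((Nat.clog 2 n * (nonemptySets S).card : ℕ) : ℝ) ≤ n * (n * (n * (3 * n))) := by
      push_cast
      gcongr
      exact h2.trans (by gcongr)
    have h5 : (n : ℝ) * (n * (n * (3 * n))) ≤ n ^ 6 := by
      have : (3 : ℝ) ≤ n ^ 2 := by nlinarith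
      calc (n : ℝ) * (n * (n * (3 * n))) = n ^ 4 * 3 := by ring
        _ ≤ n ^ 4 * n ^ 2 := by gcongr
        _ = n ^ 6 := by ring
    calc _ ≤ (n : ℝ) ^ 6 * (1 / n ^ 8) := by gcongr; exact h4.trans h5
      _ = 1 / n ^ 2 := by field_simp

end Threshold

/-! ### Randomized response -/

section RandomizedResponse

variable {n : ℕ}

/-- Symmetric difference with `R` permutes the subsets, which reduces the sum to the binomial
theorem. -/
theorem sum_exp_symmDiff (ε : ℝ) (R : Finset (Fin n)) :
    ∑ X : Finset (Fin n), Real.exp (-ε) ^ (symmDiff R X).card = (1 + Real.exp (-ε)) ^ n := by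
  have hinv : Function.Involutive fun X : Finset (Fin n) => symmDiff R X :=
    fun X => symmDiff_symmDiff_cancel_left R X
  rw [hinv.bijective.sum_comp fun X => Real.exp (-ε) ^ X.card, add_comm,
    ← Fin.sum_pow_mul_eq_add_pow]
  simp

/-- Randomized response: every element is inserted or deleted with probability
`exp (-ε) / (1 + exp (-ε))`, independently of the others. -/
noncomputable def randomizedResponse (ε : ℝ) (R : Finset (Fin n)) : PMF (Finset (Fin n)) :=
  PMF.ofFintype
    (fun X => ENNReal.ofReal (Real.exp (-ε) ^ (symmDiff R X).card / (1 + Real.exp (-ε)) ^ n)) (by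
      rw [← ENNReal.ofReal_sum_of_nonneg fun _ _ => by positivity, ← sum_div, sum_exp_symmDiff,
        div_self (by positivity), ENNReal.ofReal_one])

theorem randomizedResponse_apply (ε : ℝ) (R X : Finset (Fin n)) :
    randomizedResponse ε R X =
      ENNReal.ofReal (Real.exp (-ε) ^ (symmDiff R X).card / (1 + Real.exp (-ε)) ^ n) := rfl

theorem randomizedResponse_isNodeDP {ε : ℝ} (hε : 0 < ε) :
    IsNodeDP ε (randomizedResponse (n := n) ε) := by
  intro R₁ R₂ h
  refine toOuterMeasure_le_mul_of_apply_le fun X => ?_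
  rw [randomizedResponse_apply, randomizedResponse_apply,
    ← ENNReal.ofReal_mul (Real.exp_nonneg _), mul_div_assoc']
  apply ENNReal.ofReal_le_ofReal
  have hcard : (symmDiff R₂ X).card ≤ (symmDiff R₁ X).card + 1 := by
    have h1 := card_le_card (symmDiff_triangle R₂ R₁ X)
    have h2 : (symmDiff R₂ R₁ ⊔ symmDiff R₁ X).card ≤ _ := card_union_le _ _
    rw [symmDiff_comm R₂ R₁, show (symmDiff R₁ R₂).card = 1 from h] at h2
    rw [symmDiff_comm R₂ R₁] at h1
    exact h1.trans (h2.trans_eq (add_comm _ _))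
  gcongr
  have h1 : Real.exp (-ε) ≤ 1 := Real.exp_le_one_iff.2 (by linarith)
  calc Real.exp (-ε) ^ (symmDiff R₁ X).card
      = Real.exp ε * Real.exp (-ε) ^ ((symmDiff R₁ X).card + 1) := by
        rw [pow_succ', ← mul_assoc, ← Real.exp_add, add_neg_cancel, Real.exp_zero, one_mul]
    _ ≤ _ := mul_le_mul_of_nonneg_left
        (pow_le_pow_of_le_one (Real.exp_nonneg _) h1 hcard) (Real.exp_nonneg _)

/-- Each of the `n` elements flips with probability at most `exp (-ε) ≤ n⁻³`. -/
theorem randomizedResponse_self_ge {ε : ℝ} (hn : 0 < n) (h : 3 * Real.log n ≤ ε)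
    (R : Finset (Fin n)) :
    ENNReal.ofReal (1 - 1 / (n : ℝ) ^ 2) ≤ randomizedResponse ε R R := by
  have hn' : (0 : ℝ) < n := by exact_mod_cast hn
  rw [randomizedResponse_apply, symmDiff_self, bot_eq_empty, card_empty, pow_zero]
  apply ENNReal.ofReal_le_ofReal
  have h1 : Real.exp (-ε) ≤ 1 / (n : ℝ) ^ 3 := by
    calc Real.exp (-ε) ≤ Real.exp (-(Real.log n * 3)) := Real.exp_le_exp.2 (by linarith)
      _ = 1 / (n : ℝ) ^ 3 := by
        rw [Real.exp_neg, Real.exp_mul, Real.exp_log hn', one_div]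
        norm_cast
  calc 1 - 1 / (n : ℝ) ^ 2 = 1 - n * (1 / (n : ℝ) ^ 3) := by field_simp
    _ ≤ 1 - n * Real.exp (-ε) := by gcongr
    _ ≤ Real.exp (-(n * Real.exp (-ε))) := by
        linarith [Real.add_one_le_exp (-(n * Real.exp (-ε)))]
    _ = 1 / Real.exp (Real.exp (-ε)) ^ n := by
        rw [Real.exp_neg, ← Real.exp_nat_mul, one_div]
    _ ≤ 1 / (1 + Real.exp (-ε)) ^ n := by
        gcongr
        linarith [Real.add_one_le_exp (Real.exp (-ε))]

end RandomizedResponse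

/-! ### The combined algorithm -/

/-- A minimum cover of `R`. -/
noncomputable def optimalCover {n m : ℕ} (S : SetSystem n m) (R : Finset (Fin n)) :
    Finset (Fin m) :=
  (exists_isCover_card_eq_opt S R).choose

theorem implicitCover_optimalCover_card_le {n m : ℕ} (S : SetSystem n m) (R : Finset (Fin n)) :
    (implicitCover S R (frontOrdering (optimalCover S R))).card ≤ opt S R := by
  obtain ⟨h1, h2⟩ := (exists_isCover_card_eq_opt S R).choose_spec
  refine (implicitCover_frontOrdering_card_le S R _).trans ?_
  rw [optimalCover, h1.uncovered_eq_empty, h2, card_empty, add_zero]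

open Classical in
/-- Randomized response followed by an optimal solution if `ε` is large, and the noisy threshold
mechanism otherwise. -/
noncomputable def privateAlgorithm : ImplicitSetCoverAlgorithm := fun n _ S ε R =>
  if 3 * Real.log n ≤ ε then
    (randomizedResponse ε R).map fun X => frontOrdering (optimalCover S X)
  else (thresholdMechanism S ε R).map frontOrdering

theorem privateAlgorithm_isNodeDP {n m : ℕ} (S : SetSystem n m) {ε : ℝ} (hε : 0 < ε) :
    IsNodeDP ε (privateAlgorithm n m S ε) := by
  by_cases h : 3 * Real.log n ≤ ε
  · rw [show privateAlgorithm n m S ε = fun R => (randomizedResponse ε R).map fun X =>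
      frontOrdering (optimalCover S X) from funext fun _ => if_pos h]
    exact (randomizedResponse_isNodeDP hε).map _
  · rw [show privateAlgorithm n m S ε = fun R => (thresholdMechanism S ε R).map frontOrdering
      from funext fun _ => if_neg h]
    exact (thresholdMechanism_isNodeDP S hε).map _

theorem clog_two_le_three_mul_log {n : ℕ} (hn : 2 ≤ n) :
    (Nat.clog 2 n : ℝ) ≤ 3 * Real.log n := by
  have hn' : (2 : ℝ) ≤ n := by exact_mod_cast hn
  have h1 := Real.log_two_gt_d9
  have h2 : Real.log 2 ≤ Real.log n := Real.log_le_log (by norm_num) hn'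
  have hL : 1 ≤ Nat.clog 2 n := Nat.clog_pos (by norm_num) hn
  obtain ⟨k, hk⟩ : ∃ k, Nat.clog 2 n = k + 1 := ⟨_, (Nat.sub_add_cancel hL).symm⟩
  have h3 : 2 ^ k < n := (Nat.lt_clog_iff_pow_lt (by norm_num)).1 (by omega)
  have h4 : (k : ℝ) * Real.log 2 ≤ Real.log n := by
    rw [← Real.log_pow]
    exact Real.log_le_log (by positivity) (by exact_mod_cast h3.le)
  rw [hk]
  push_cast
  -- Both `k` and `1` are at most `log n / log 2`, and `2 / log 2 < 3`.
  nlinarith [Nat.cast_nonneg (α := ℝ) k]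

theorem privateAlgorithm_accuracy {n m : ℕ} (S : SetSystem n m) {ε : ℝ} (hε : 0 < ε)
    (hn : 2 ≤ n) (R : Finset (Fin n)) :
    ENNReal.ofReal (1 - 1 / (n : ℝ) ^ 2) ≤
      (privateAlgorithm n m S ε R).toOuterMeasure
        {σ | ((implicitCover S R σ).card : ℝ) ≤
          120 * Real.log n ^ 2 * max 1 ((maxDegree S : ℝ) / ε) * (opt S R : ℝ)} := by
  have hn' : (2 : ℝ) ≤ n := by exact_mod_cast hn
  have hlog2 := Real.log_two_gt_d9
  have hlog : Real.log 2 ≤ Real.log n := Real.log_le_log (by norm_num) hn'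
  set b : ℝ := max 1 ((maxDegree S : ℝ) / ε) with hb
  have hb1 : 1 ≤ b := le_max_left _ _
  have hbf : (maxDegree S : ℝ) / ε ≤ b := le_max_right _ _
  have hone : 1 ≤ 120 * Real.log n ^ 2 := by nlinarith
  have hfac : b ≤ 120 * Real.log n ^ 2 * b := le_mul_of_one_le_left (by linarith) hone
  have hopt : (0 : ℝ) ≤ opt S R := Nat.cast_nonneg _
  have hall : (∀ σ : Ordering m, ((implicitCover S R σ).card : ℝ) ≤
      120 * Real.log n ^ 2 * b * (opt S R : ℝ)) →
      ENNReal.ofReal (1 - 1 / (n : ℝ) ^ 2) ≤ (privateAlgorithm n m S ε R).toOuterMeasure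
        {σ | ((implicitCover S R σ).card : ℝ) ≤
          120 * Real.log n ^ 2 * b * (opt S R : ℝ)} := by
    intro h
    refine le_trans (ENNReal.ofReal_le_one.2 ?_) ((toOuterMeasure_univ_eq_one _).ge.trans
      (MeasureTheory.measure_mono fun σ _ => h σ))
    linarith [show (0 : ℝ) ≤ 1 / (n : ℝ) ^ 2 by positivity]
  rcases (uncovered S R ∅).eq_empty_or_nonempty with hU | hU
  · refine hall fun σ => ?_
    have := implicitCover_card_le_uncovered_empty S R σ
    rw [hU, card_empty, Nat.le_zero] at this
    rw [this, Nat.cast_zero]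
    positivity
  have hopt1 : (1 : ℝ) ≤ opt S R := by exact_mod_cast one_le_opt S R hU
  -- If `f / ε ≥ n`, every ordering is good enough, since its cost is at most `n` and `OPT ≥ 1`.
  -- Otherwise `f < n * ε`, as the union bound needs.
  by_cases hfn : (n : ℝ) * ε ≤ maxDegree S
  · refine hall fun σ => ?_
    have h1 : ((implicitCover S R σ).card : ℝ) ≤ n := by
      have := (implicitCover_card_le_uncovered_empty S R σ).trans (card_le_univ _)
      rw [Fintype.card_fin] at this
      exact_mod_cast this
    have h2 : (n : ℝ) ≤ b := ((le_div_iff₀ hε).2 hfn).trans hbf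
    calc _ ≤ b := h1.trans h2
      _ ≤ 120 * Real.log n ^ 2 * b := hfac
      _ ≤ _ := le_mul_of_one_le_right (by positivity) hopt1
  by_cases hεn : 3 * Real.log n ≤ ε
  · rw [privateAlgorithm, if_pos hεn, PMF.toOuterMeasure_map_apply]
    refine (randomizedResponse_self_ge (by omega) hεn R).trans ?_
    rw [← PMF.toOuterMeasure_apply_singleton]
    refine (PMF.toOuterMeasure _).mono (Set.singleton_subset_iff.2 ?_)
    have h1 : ((implicitCover S R (frontOrdering (optimalCover S R))).card : ℝ) ≤ opt S R := by
      exact_mod_cast implicitCover_optimalCover_card_le S R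
    exact h1.trans (le_mul_of_one_le_left hopt (hb1.trans hfac))
  · rw [privateAlgorithm, if_neg hεn, PMF.toOuterMeasure_map_apply]
    have hf : 0 < maxDegree S := by
      obtain ⟨u, hu⟩ := hU
      obtain ⟨i, hi⟩ := (mem_filter.1 hu).2.1
      exact (card_pos.2 ⟨i, mem_filter.2 ⟨mem_univ i, hi⟩⟩).trans_le (degree_le_maxDegree S u)
    refine (thresholdMechanism_accuracy S hε hn (not_le.1 hεn).le hf (not_le.1 hfn).le R).trans
      ((PMF.toOuterMeasure _).mono fun P hP => ?_)
    have h1 : ((implicitCover S R (frontOrdering P)).card : ℝ) ≤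
        P.card + (uncovered S R P).card := by
      exact_mod_cast implicitCover_frontOrdering_card_le S R P
    refine (h1.trans hP).trans (mul_le_mul_of_nonneg_right ?_ hopt)
    have h2 := clog_two_le_three_mul_log hn
    -- The constant is `120 = 4 * 3 * (2 + 8)`, with the summand 1 absorbed into `2 * log n * b`.
    calc 4 * (Nat.clog 2 n : ℝ) * (1 + 8 * Real.log n * (maxDegree S / ε))
        ≤ 4 * (3 * Real.log n) * (2 * Real.log n * b + 8 * Real.log n * b) := by
          have : 1 ≤ 2 * Real.log n * b := one_le_mul_of_one_le_of_one_le (by linarith) hb1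
          have : 0 ≤ Real.log n := by linarith
          gcongr
      _ = 120 * Real.log n ^ 2 * b := by ring

end PrivateSetCover

theorem mainTheorem5 :
    ∃ (C : ℝ) (c : ℕ) (A : PrivateSetCover.ImplicitSetCoverAlgorithm),
      ∀ (n m : ℕ) (S : PrivateSetCover.SetSystem n m) (ε : ℝ), 0 < ε →
        PrivateSetCover.IsNodeDP ε (A n m S ε) ∧
        (2 ≤ n → ∀ R : Finset (Fin n),
          ENNReal.ofReal (1 - 1 / (n : ℝ) ^ 2) ≤
            (A n m S ε R).toOuterMeasure
              {σ | ((PrivateSetCover.implicitCover S R σ).card : ℝ) ≤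
                C * Real.log n ^ c * max 1 ((PrivateSetCover.maxDegree S : ℝ) / ε) *
                  (PrivateSetCover.opt S R : ℝ)}) :=
  ⟨120, 2, PrivateSetCover.privateAlgorithm, fun _ _ S _ hε =>
    ⟨PrivateSetCover.privateAlgorithm_isNodeDP S hε,
      fun hn R => PrivateSetCover.privateAlgorithm_accuracy S hε hn R⟩⟩
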